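/- Let $n,q$ be nonnegative integers, let $v\in\mathbb{R}^n$ have positive entries, and let $\mathcal{M}=\mathcal{F}_v=\{X\in\mathbb{R}^{n\times q}: X^TX=I_q,\ v\in\mathrm{span}(X)\}$, where $\mathrm{span}(X)$ is the column space of $X$. Use the Euclidean inner product $\langle U,V\rangle=\mathrm{trace}(U^TV)$ with norm $\|\cdot\|$, and let $T_x\mathcal{M}$ be the tangent space of $\mathcal M$ at $x$ and $P_{T_x\mathcal{M}}$ the orthogonal projection onto it. Let $F=f+g$, where $g(x)=\lambda\|x\|_1$ (entrywise $\ell_1$ norm) with $\lambda\ge 0$, and $f:\mathbb{R}^{n\times q}\to\mathbb{R}$ is differentiable at every point of $\mathcal{M}$. Assume that $\nabla f$ is Lipschitz continuous on $\mathcal{M}$ with constant $L_f$ and that $g$ is Lipschitz continuous with constant $L_g$ (both in the Euclidean sense). Let $R$ be a retraction on $\mathcal{M}$, i.e. a smooth map $(x,\eta)\mapsto R_x(\eta)\in\mathcal{M}$ defined on an open subset of the tangent bundle $T\mathcal{M}$ (possibly all of it) that contains the zero section, with $R_x(0)=x$ and $\frac{d}{dt}R_x(t\eta)|_{t=0}=\eta$.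 Let $\mu>0$, $\sigma\in(0,1/(8\mu)]$, $\nu\in(0,1)$. For each $x\in\mathcal M$ let $B_x$ be the linear map $u\mapsto\sum_i u_iV_i$ defined by an orthonormal basis $(V_i)$ of the normal space $(T_x\mathcal{M})^\perp$, and $B_x^T$ its adjoint. An *admissible inexact direction* at $x$ is a vector $\eta$ such that, for some $\Lambda$, with $\mathrm{grad} f(x)=P_{T_x\mathcal M}\nabla f(x)$, $\mathrm{Prox}_{\mu g}(z)=\mathrm{argmin}_w\,\frac12\|w-z\|^2+\mu g(w)$ and $v(\Lambda)=\mathrm{Prox}_{\mu g}\big(x-\mu(\mathrm{grad} f(x)-B_x\Lambda)\big)-x$, one has $$\eta=P_{T_x\mathcal{M}}v(\Lambda),\qquad \|B_x^Tv(\Lambda)\|\le\sqrt{4\mu^2L_g^2+\|\eta\|^2/2}-2\mu L_g .$$ (It approximates the minimizer of $\langle\mathrm{grad} f(x),\eta\rangle+\frac1{2\mu}\|\eta\|^2+g(x+\eta)$ over $\eta\in T_x\mathcal{M}$.) Given positive integers $N$ and $N_{\max}$ and $x_0\in\mathcal{M}$, the algorithm AManPG sets $t_0=1$, $y_0=z_0=x_0$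 and performs the following for $k=0,1,2,\dots$. 1. (Safeguard.) If $N$ divides $k$: take an admissible inexact direction $\eta_{z_k}$ at $z_k$. Set $\alpha=1$, $i=0$; while $F(R_{z_k}(\alpha\eta_{z_k}))>F(z_k)-\sigma\alpha\|\eta_{z_k}\|^2$ and $i<N_{\max}$, replace $\alpha$ by $\nu\alpha$ and $i$ by $i+1$. The line search is said to fail if the loop ends with $i=N_{\max}$. If $F(R_{z_k}(\alpha\eta_{z_k}))<F(x_k)$, replace $x_k$ and $y_k$ by $R_{z_k}(\alpha\eta_{z_k})$ and $t_k$ by $1$; otherwise keep $x_k,y_k,t_k$. Set $z_{k+N}=x_k$. 2. Take an admissible inexact direction $\eta_{y_k}$ at $y_k$ and set $x_{k+1}=R_{y_k}(\eta_{y_k})$, $t_{k+1}=\frac{\sqrt{4t_k^2+1}+1}{2}$, and $y_{k+1}=R_{x_{k+1}}\big(\frac{1-t_k}{t_{k+1}}P_{T_{x_{k+1}}\mathcal{M}}(x_k-x_{k+1})\big)$. Consider infinite runs of this algorithm in which every evaluation of $R$ is at a point of its domain. Then there is an integer $\bar N$, depending only on $n,q,v,f,L_f,\lambda,L_g,R,\mu,\sigma,\nu$,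 such that for all choices of the normal bases, $N$, $N_{\max}$ and all runs: (a) if $N_{\max}\ge\bar N$, then the line search never fails; (b) if the line search never fails, in particular whenever $N_{\max}\ge\bar N$, then every accumulation point $z_*$ of the sequence $z_0,z_N,z_{2N},\dots,z_{iN},\dots$ is a stationary point: $z_*\in\mathcal{M}$ and $0\in P_{T_{z_*}\mathcal{M}}\,\partial F(z_*)$. Here $\partial F(z)$ is the (Fréchet) subdifferential of $F$, the set of all $\xi$ with $F(y)\ge F(z)+\langle\xi,y-z\rangle-o(\|y-z\|)$ as $y\to z$; it equals $\nabla f(z)+\partial g(z)$, $\partial g$ being the convex subdifferential, for $z\in\mathcal{M}$. -/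

import Mathlib

open Set Filter Topology
open scoped ContDiff

/-- The space `ℝ^{n × q}` of real matrices with the Euclidean (Frobenius) inner product
`⟪U, V⟫ = trace (Uᵀ V)`. -/
abbrev MatSpace (n q : ℕ) : Type := EuclideanSpace ℝ (Fin n × Fin q)

/-- An element of `MatSpace n q`, read as a matrix. -/
def toMat {n q : ℕ} (x : MatSpace n q) : Matrix (Fin n) (Fin q) ℝ := fun i j => x (i, j)

/-- The feasible set `𝓕_v = {X ∈ ℝ^{n × q} : Xᵀ X = I, v ∈ span X}`, where `span X` is the
column space of `X`. -/
def feasible {n : ℕ} (q : ℕ) (v : Fin n → ℝ) : Set (MatSpace n q) :=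
  {x | (toMat x).transpose * toMat x = 1 ∧ v ∈ Set.range (toMat x).mulVec}

/-- The tangent space of `𝓕_v` at `X`: all `η` such that `Xᵀ η` is skew-symmetric and
`(I - X Xᵀ) η Xᵀ v = 0`, i.e. all `X Ω + X_⊥ K` with `Ωᵀ = -Ω` and `K Xᵀ v = 0`.
`mem_tangentSpace_iff` below shows that for `X ∈ 𝓕_v` these are exactly the velocities at `X` of
curves in `𝓕_v`. -/
def tangentSpace {n q : ℕ} (v : Fin n → ℝ) (x : MatSpace n q) : Submodule ℝ (MatSpace n q) where
  carrier := {η | (toMat x).transpose * toMat η + (toMat η).transpose * toMat x = 0 ∧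
    (toMat η - toMat x * ((toMat x).transpose * toMat η)).mulVec
      ((toMat x).transpose.mulVec v) = 0}
  zero_mem' := by
    have h : toMat (0 : MatSpace n q) = 0 := rfl
    simp [h]
  add_mem' := by
    rintro a b ⟨ha, ha'⟩ ⟨hb, hb'⟩
    have h : toMat (a + b) = toMat a + toMat b := rfl
    refine ⟨?_, ?_⟩
    · rw [h, Matrix.transpose_add, Matrix.mul_add, Matrix.add_mul, add_add_add_comm, ha, hb,
        add_zero]
    · rw [h, Matrix.mul_add, Matrix.mul_add, add_sub_add_comm, Matrix.add_mulVec, ha', hb',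
        add_zero]
  smul_mem' := by
    rintro c a ⟨ha, ha'⟩
    have h : toMat (c • a) = c • toMat a := rfl
    refine ⟨?_, ?_⟩
    · rw [h, Matrix.transpose_smul, Matrix.mul_smul, Matrix.smul_mul, ← smul_add, ha, smul_zero]
    · rw [h, Matrix.mul_smul, Matrix.mul_smul, ← smul_sub, Matrix.smul_mulVec, ha', smul_zero]

theorem hasDerivAt_mul_apply {l m p : Type*} [Fintype m]
    {A : ℝ → Matrix l m ℝ} {B : ℝ → Matrix m p ℝ} {A' : Matrix l m ℝ} {B' : Matrix m p ℝ} {t : ℝ}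
    (hA : ∀ i j, HasDerivAt (fun s => A s i j) (A' i j) t)
    (hB : ∀ i j, HasDerivAt (fun s => B s i j) (B' i j) t) (i : l) (j : p) :
    HasDerivAt (fun s => (A s * B s) i j) ((A' * B t + A t * B') i j) t := by
  simp only [Matrix.mul_apply, Matrix.add_apply, ← Finset.sum_add_distrib]
  exact HasDerivAt.fun_sum fun k _ => (hA i k).mul (hB k j)

theorem mul_transpose_mulVec_of_mem {n q : ℕ} {v : Fin n → ℝ} {x : MatSpace n q}
    (hx : x ∈ feasible q v) :
    (toMat x).mulVec ((toMat x).transpose.mulVec v) = v := by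
  obtain ⟨h1, a, ha⟩ := hx
  rw [← ha, Matrix.mulVec_mulVec _ (toMat x).transpose, h1, Matrix.one_mulVec]

open scoped Matrix.Norms.Operator in
theorem hasDerivAt_exp_smul_apply {m : ℕ} (W : Matrix (Fin m) (Fin m) ℝ) (i j : Fin m) :
    HasDerivAt (fun t : ℝ => (NormedSpace.exp (t • W)) i j) (W i j) 0 := by
  have h := hasDerivAt_exp_smul_const (𝕂 := ℝ) W (0 : ℝ)
  have h' := (Matrix.entryLinearMap ℝ ℝ i j).toContinuousLinearMap.hasFDerivAt.comp_hasDerivAt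
    (0 : ℝ) h
  have e : (1 : Matrix (Fin m) (Fin m) ℝ) * W = W := one_mul W
  rw [zero_smul, NormedSpace.exp_zero, e] at h'
  exact h'

open scoped Matrix.Norms.Operator in
theorem exp_skew_mul {m : ℕ} {W : Matrix (Fin m) (Fin m) ℝ} (hW : W.transpose = -W) (t : ℝ) :
    (NormedSpace.exp (t • W)).transpose * NormedSpace.exp (t • W) = 1 := by
  have hc : Commute (-(t • W)) (t • W) := Commute.neg_left (Commute.refl (t • W))
  rw [← Matrix.exp_transpose, Matrix.transpose_smul, hW, smul_neg,
    ← Matrix.exp_add_of_commute _ _ hc, neg_add_cancel, NormedSpace.exp_zero]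

open scoped Matrix.Norms.Operator in
theorem exp_mulVec_of_ker {m : ℕ} {W : Matrix (Fin m) (Fin m) ℝ} {v : Fin m → ℝ}
    (hW : W.mulVec v = 0) (t : ℝ) : (NormedSpace.exp (t • W)).mulVec v = v := by
  let V : Matrix (Fin m) (Fin m) ℝ := Matrix.of fun i _ => v i
  have h : SemiconjBy V 0 (t • W) := by
    show V * 0 = (t • W) * V
    rw [mul_zero, Matrix.smul_mul]
    ext i j
    have := congrFun hW i
    simp only [Matrix.mulVec, dotProduct, Pi.zero_apply] at this
    simp [Matrix.mul_apply, V, this]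
  have h2 : V * NormedSpace.exp 0 = NormedSpace.exp (t • W) * V := h.exp_right
  rw [NormedSpace.exp_zero, mul_one] at h2
  ext i
  have := congrFun (congrFun h2 i) i
  simp only [Matrix.mul_apply, V, Matrix.of_apply] at this
  simp only [Matrix.mulVec, dotProduct]
  exact this.symm

/-- The tangent space of `𝓕_v` at `x` consists of the velocities of curves in `𝓕_v` through `x`. -/
theorem mem_tangentSpace_iff {n q : ℕ} {v : Fin n → ℝ} {x : MatSpace n q}
    (hx : x ∈ feasible q v) (η : MatSpace n q) :
    η ∈ tangentSpace v x ↔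
      ∃ γ : ℝ → MatSpace n q, (∀ t, γ t ∈ feasible q v) ∧ γ 0 = x ∧ HasDerivAt γ η 0 := by
  constructor
  · rintro ⟨h1, h2⟩
    set X := toMat x with hX
    set H := toMat η with hH
    set Ω := X.transpose * H with hΩ
    set K := H - X * Ω with hK
    have hXX : X.transpose * X = 1 := hx.1
    have hΩs : Ω.transpose = -Ω := by
      rw [hΩ, Matrix.transpose_mul, Matrix.transpose_transpose]
      exact eq_neg_of_add_eq_zero_right h1
    have hKX : X.transpose * K = 0 := by
      rw [hK, Matrix.mul_sub, ← Matrix.mul_assoc, hXX, Matrix.one_mul, hΩ, sub_self]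
    have hKX' : K.transpose * X = 0 := by
      have := congrArg Matrix.transpose hKX
      simpa [Matrix.transpose_mul] using this
    set W := K * X.transpose - X * K.transpose with hW
    have hWs : W.transpose = -W := by
      rw [hW]; simp [Matrix.transpose_mul]
    have hWv : W.mulVec v = 0 := by
      have e := mul_transpose_mulVec_of_mem hx
      have e' : K.transpose.mulVec v = 0 := by
        rw [← e, Matrix.mulVec_mulVec, hKX', Matrix.zero_mulVec]
      rw [hW, Matrix.sub_mulVec, ← Matrix.mulVec_mulVec, h2, zero_sub, neg_eq_zero,
        ← Matrix.mulVec_mulVec, e', Matrix.mulVec_zero]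
    let G : ℝ → Matrix (Fin n) (Fin q) ℝ := fun t =>
      NormedSpace.exp (t • W) * X * NormedSpace.exp (t • Ω)
    let γ : ℝ → MatSpace n q := fun t => WithLp.toLp 2 fun p => G t p.1 p.2
    have hγm : ∀ t, toMat (γ t) = G t := fun t => rfl
    refine ⟨γ, fun t => ⟨?_, ?_⟩, ?_, ?_⟩
    · have a1 := exp_skew_mul hWs t
      have a2 := exp_skew_mul hΩs t
      rw [hγm]
      simp only [G, Matrix.transpose_mul]
      calc _ = (NormedSpace.exp (t • Ω)).transpose * (X.transpose *
            ((NormedSpace.exp (t • W)).transpose * NormedSpace.exp (t • W)) * X) *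
            NormedSpace.exp (t • Ω) := by simp only [Matrix.mul_assoc]
        _ = 1 := by rw [a1, Matrix.mul_one, hXX, Matrix.mul_one, a2]
    · have a2 : NormedSpace.exp (t • Ω) * (NormedSpace.exp (t • Ω)).transpose = 1 :=
        mul_eq_one_comm.mp (exp_skew_mul hΩs t)
      refine ⟨(NormedSpace.exp (t • Ω)).transpose.mulVec (X.transpose.mulVec v), ?_⟩
      rw [hγm]
      simp only [G]
      rw [← Matrix.mulVec_mulVec _ _ (NormedSpace.exp (t • Ω)),
        Matrix.mulVec_mulVec _ (NormedSpace.exp (t • Ω)), a2, Matrix.one_mulVec,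
        ← Matrix.mulVec_mulVec, mul_transpose_mulVec_of_mem hx, exp_mulVec_of_ker hWv]
    · ext p
      show G 0 p.1 p.2 = x p
      simp [G, NormedSpace.exp_zero, hX, toMat]
    · have hG : ∀ i j, HasDerivAt (fun t => G t i j) (H i j) 0 := by
        intro i j
        have b1 : ∀ i j, HasDerivAt (fun t : ℝ => (NormedSpace.exp (t • W) * X) i j)
            ((W * X + NormedSpace.exp ((0 : ℝ) • W) * (0 : Matrix (Fin n) (Fin q) ℝ)) i j) 0 :=
          hasDerivAt_mul_apply (hasDerivAt_exp_smul_apply W) (fun i j => hasDerivAt_const _ _)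
        have b2 := hasDerivAt_mul_apply b1 (hasDerivAt_exp_smul_apply Ω) i j
        have b3 : W * X + X * Ω = H := by
          rw [hW, Matrix.sub_mul, Matrix.mul_assoc, hXX, Matrix.mul_assoc, hKX', Matrix.mul_zero,
            sub_zero, Matrix.mul_one, hK, sub_add_cancel]
        simp only [zero_smul, NormedSpace.exp_zero, Matrix.mul_zero, add_zero, Matrix.mul_one,
          Matrix.one_mul, b3] at b2
        exact b2
      exact (EuclideanSpace.equiv (Fin n × Fin q) ℝ).symm.hasFDerivAt.comp_hasDerivAt (0 : ℝ)
        (hasDerivAt_pi.2 fun p => hG p.1 p.2)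
  · rintro ⟨γ, hγ, h0, hd⟩
    have hent : ∀ i j, HasDerivAt (fun s => toMat (γ s) i j) (toMat η i j) 0 := fun i j =>
      (EuclideanSpace.proj (𝕜 := ℝ) (i, j)).hasFDerivAt.comp_hasDerivAt (0 : ℝ) hd
    have hent' : ∀ i j, HasDerivAt (fun s => (toMat (γ s)).transpose i j)
        ((toMat η).transpose i j) 0 := fun i j => hent j i
    have c1 : (toMat x).transpose * toMat η + (toMat η).transpose * toMat x = 0 := by
      ext i j
      have d := hasDerivAt_mul_apply hent' hent i j
      simp only [(hγ _).1] at d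
      rw [h0, add_comm] at d
      exact d.unique (hasDerivAt_const _ _)
    refine ⟨c1, ?_⟩
    have e := mul_transpose_mulVec_of_mem hx
    have c2 : (toMat η * (toMat x).transpose + toMat x * (toMat η).transpose).mulVec v = 0 := by
      ext i
      have d : HasDerivAt (fun s => ∑ k, (toMat (γ s) * (toMat (γ s)).transpose) i k * v k)
          (∑ k, (toMat η * (toMat (γ 0)).transpose + toMat (γ 0) * (toMat η).transpose) i k * v k)
          0 :=
        HasDerivAt.fun_sum fun k _ => (hasDerivAt_mul_apply hent hent' i k).mul_const (v k)
      have d' : (fun s => ∑ k, (toMat (γ s) * (toMat (γ s)).transpose) i k * v k) =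
          fun _ => v i := by
        funext s
        have := congrFun (mul_transpose_mulVec_of_mem (hγ s)) i
        rw [Matrix.mulVec_mulVec] at this
        exact this
      rw [d', h0] at d
      exact d.unique (hasDerivAt_const _ _)
    have c3 : (toMat η).transpose * toMat x = -((toMat x).transpose * toMat η) :=
      eq_neg_of_add_eq_zero_right c1
    have c4 : (toMat η).transpose.mulVec v =
        -((toMat x).transpose * toMat η).mulVec ((toMat x).transpose.mulVec v) := by
      conv_lhs => rw [← e]
      rw [Matrix.mulVec_mulVec, c3, Matrix.neg_mulVec]
    rw [Matrix.add_mulVec, ← Matrix.mulVec_mulVec, ← Matrix.mulVec_mulVec, c4,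
      Matrix.mulVec_neg, ← sub_eq_add_neg] at c2
    rw [Matrix.sub_mulVec, ← Matrix.mulVec_mulVec _ (toMat x)]
    exact c2

/-- The entrywise `ℓ₁` norm `‖X‖₁`. -/
noncomputable def l1Norm {n q : ℕ} (x : MatSpace n q) : ℝ := ∑ p, |x p|

/-- The regularizer `g(x) = λ ‖x‖₁`. -/
noncomputable def regularizer {n q : ℕ} (lam : ℝ) (x : MatSpace n q) : ℝ := lam * l1Norm x

/-- The objective `F = f + g`. -/
noncomputable def objective {n q : ℕ} (f : MatSpace n q → ℝ) (lam : ℝ) (x : MatSpace n q) : ℝ :=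
  f x + regularizer lam x

/-- The (regular, or Fréchet) subdifferential of a function on a Euclidean space: all `ξ` with
`F y ≥ F x + ⟪ξ, y - x⟫ - o(‖y - x‖)` as `y → x`. For a sum of a differentiable and a convex
function it is the gradient plus the convex subdifferential
(`mem_subdifferential_add_iff`). It is contained in the Clarke subdifferential of a locally
Lipschitz function, with equality for `F = f + g` as above with `f` continuously differentiable. -/
def subdifferential {E : Type*} [NormedAddCommGroup E] [InnerProductSpace ℝ E]
    (F : E → ℝ) (x : E) : Set E :=
  {ξ | ∀ ε > 0, ∀ᶠ y in 𝓝 x, F x + inner ℝ ξ (y - x) - ε * ‖y - x‖ ≤ F y}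

theorem mem_subdifferential_add_iff {E : Type*} [NormedAddCommGroup E] [InnerProductSpace ℝ E]
    [CompleteSpace E] {f g : E → ℝ} {x : E} (hf : DifferentiableAt ℝ f x)
    (hg : ConvexOn ℝ Set.univ g) (ξ : E) :
    ξ ∈ subdifferential (fun y => f y + g y) x ↔
      ∀ y, g x + inner ℝ (ξ - gradient f x) (y - x) ≤ g y := by
  have hd := hasGradientAt_iff_isLittleO.1 hf.hasGradientAt
  constructor
  · intro h y
    refine le_of_forall_pos_le_add fun δ hδ => ?_
    set ε : ℝ := δ / (2 * (‖y - x‖ + 1)) with hε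
    have hε0 : 0 < ε := by positivity
    have hεy : 2 * ε * ‖y - x‖ ≤ δ := by
      have : 2 * ε * (‖y - x‖ + 1) = δ := by rw [hε]; field_simp
      nlinarith
    have h1 := h ε hε0
    have h2 := hd.def hε0
    have ht : Tendsto (fun t : ℝ => x + t • (y - x)) (𝓝[>] 0) (𝓝 x) := by
      have : Continuous fun t : ℝ => x + t • (y - x) := by fun_prop
      simpa using (this.tendsto 0).mono_left nhdsWithin_le_nhds
    have h3 := ht.eventually (h1.and h2)
    have h4 : ∀ᶠ t : ℝ in 𝓝[>] 0, t ∈ Set.Ioo (0 : ℝ) 1 := Ioo_mem_nhdsGT one_pos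
    obtain ⟨t, ⟨h5, h6⟩, ht0, ht1⟩ := (h3.and h4).exists
    have h7 := hg.2 (Set.mem_univ x) (Set.mem_univ y) (sub_nonneg.2 ht1.le) ht0.le (by ring)
    have h8 : (1 - t) • x + t • y = x + t • (y - x) := by
      rw [sub_smul, one_smul, smul_sub]; abel
    rw [h8, smul_eq_mul, smul_eq_mul] at h7
    simp only [add_sub_cancel_left, inner_smul_right, norm_smul, Real.norm_eq_abs,
      abs_of_pos ht0] at h5 h6
    have h9 := (abs_le.1 h6).2
    have h10 : t * (g x + inner ℝ (ξ - gradient f x) (y - x)) ≤ t * (g y + δ) := by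
      rw [inner_sub_left]
      nlinarith [mul_le_mul_of_nonneg_left hεy ht0.le]
    exact le_of_mul_le_mul_left h10 ht0
  · intro h ε hε
    filter_upwards [hd.def hε] with y hy
    have h1 := h y
    rw [inner_sub_left] at h1
    have h2 := (abs_le.1 hy).1
    linarith

/-- The set of minimizers defining `Prox_{μ g}(z) = argmin_w ½ ‖w - z‖² + μ g(w)`; for convex `g`
it has exactly one element. -/
def IsProx {n q : ℕ} (μ : ℝ) (g : MatSpace n q → ℝ) (z p : MatSpace n q) : Prop :=
  ∀ w, 1 / 2 * ‖p - z‖ ^ 2 + μ * g p ≤ 1 / 2 * ‖w - z‖ ^ 2 + μ * g w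

/-- The Riemannian gradient of `f` at `x` for the Euclidean metric: the tangent vector
representing the derivative of `f` on the tangent space. -/
noncomputable def riemGrad {n q : ℕ} (v : Fin n → ℝ) (f : MatSpace n q → ℝ) (x : MatSpace n q) :
    MatSpace n q :=
  (tangentSpace v x).starProjection (gradient f x)

/-- The tangent bundle of `𝓕_v`. -/
def tangentBundle {n : ℕ} (q : ℕ) (v : Fin n → ℝ) : Set (MatSpace n q × MatSpace n q) :=
  {p | p.1 ∈ feasible q v ∧ p.2 ∈ tangentSpace v p.1}

/-- `R`, written `(x, η) ↦ R_x(η)`, is a retraction on `𝓕_v` with domain `D`: the set `D` is open in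
the tangent bundle and contains the zero section, `R` is a smooth map from `D` to `𝓕_v`,
`R_x(0) = x` and `d/dt R_x(t η) = η` at `t = 0`. The domain may be the whole tangent bundle. -/
structure IsRetraction {n q : ℕ} (v : Fin n → ℝ) (D : Set (MatSpace n q × MatSpace n q))
    (R : MatSpace n q × MatSpace n q → MatSpace n q) : Prop where
  isOpen_domain : ∃ U, IsOpen U ∧ D = tangentBundle q v ∩ U
  zero_mem : ∀ x ∈ feasible q v, (x, 0) ∈ D
  mapsTo : ∀ p ∈ D, R p ∈ feasible q v
  smooth : ContDiffOn ℝ ∞ R D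
  map_zero : ∀ x ∈ feasible q v, R (x, 0) = x
  hasDerivAt : ∀ p ∈ tangentBundle q v, HasDerivAt (fun t : ℝ => R (p.1, t • p.2)) p.2 0

/-- A choice, for every `x`, of an orthonormal basis of the normal space `N_x = (T_x)^⊥`. -/
abbrev NormalFrame {n : ℕ} (q : ℕ) (v : Fin n → ℝ) : Type :=
  (x : MatSpace n q) → OrthonormalBasis (Fin (Module.finrank ℝ (tangentSpace v x)ᗮ)) ℝ
    (tangentSpace v x)ᗮ

/-- The linear map `B_x : u ↦ ∑ uᵢ Vᵢ`, where `(Vᵢ)` is the chosen orthonormal basis of the normal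
space at `x`. Its transpose `B_xᵀ` is its adjoint `V ↦ (⟪Vᵢ, V⟫)ᵢ`. -/
noncomputable def normalMap {n q : ℕ} {v : Fin n → ℝ} (B : NormalFrame q v) (x : MatSpace n q) :
    EuclideanSpace ℝ (Fin (Module.finrank ℝ (tangentSpace v x)ᗮ)) →L[ℝ] MatSpace n q :=
  (tangentSpace v x)ᗮ.subtypeL ∘L ((B x).repr.symm.toContinuousLinearEquiv :
    EuclideanSpace ℝ (Fin (Module.finrank ℝ (tangentSpace v x)ᗮ)) →L[ℝ] (tangentSpace v x)ᗮ)

/-- `η` is an admissible approximate solution of the subproblem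
`min_{η ∈ T_x} ⟪grad f(x), η⟫ + ‖η‖² / (2 μ) + g(x + η)`: for some `Λ`, with
`v(Λ) = Prox_{μ g}(x - μ (grad f(x) - B_x Λ)) - x` and `Ψ(Λ) = B_xᵀ v(Λ)`, it is the projection
of `v(Λ)` to the tangent space, and
`‖Ψ(Λ)‖ ≤ √(4 μ² L_g² + ‖η‖² / 2) - 2 μ L_g`. -/
def IsInexactDirection {n q : ℕ} (v : Fin n → ℝ) (f : MatSpace n q → ℝ) (lam Lg μ : ℝ)
    (B : NormalFrame q v) (x η : MatSpace n q) : Prop :=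
  ∃ (Λ : EuclideanSpace ℝ (Fin (Module.finrank ℝ (tangentSpace v x)ᗮ))) (p : MatSpace n q),
    IsProx μ (regularizer lam) (x - μ • (riemGrad v f x - normalMap B x Λ)) p ∧
    η = (tangentSpace v x).starProjection (p - x) ∧
    ‖(normalMap B x).adjoint (p - x)‖ ≤
      Real.sqrt (4 * μ ^ 2 * Lg ^ 2 + ‖η‖ ^ 2 / 2) - 2 * μ * Lg

/-- An infinite run of the inexact accelerated manifold proximal gradient method. The variables
`x k, y k, t k` are the values at the start of iteration `k`, and `xs k, ys k, ts k` those after the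
safeguard block of iteration `k`. The values `z k, etaZ k, iter k` matter for multiples `k` of `N`
only; `iter k` is the value of the line search counter when the line search loop ends, so that the
step size is `ν ^ iter k`. Every evaluation of the retraction has to be at a point of its domain. -/
structure AManPGRun {n q : ℕ} (v : Fin n → ℝ) (f : MatSpace n q → ℝ) (lam Lg : ℝ)
    (D : Set (MatSpace n q × MatSpace n q)) (R : MatSpace n q × MatSpace n q → MatSpace n q)
    (B : NormalFrame q v) (μ σ ν : ℝ) (N Nmax : ℕ) where
  (x y xs ys z etaY etaZ : ℕ → MatSpace n q)
  (t ts : ℕ → ℝ)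
  iter : ℕ → ℕ
  x_zero_mem : x 0 ∈ feasible q v
  t_zero : t 0 = 1
  y_zero : y 0 = x 0
  z_zero : z 0 = x 0
  -- the safeguard, in the iterations that are multiples of `N`
  etaZ_inexact : ∀ k, k % N = 0 → IsInexactDirection v f lam Lg μ B (z k) (etaZ k)
  search_mem : ∀ k, k % N = 0 → ∀ i ≤ iter k, (z k, ν ^ i • etaZ k) ∈ D
  search_continue : ∀ k, k % N = 0 → ∀ i < iter k,
    objective f lam (R (z k, ν ^ i • etaZ k)) >
      objective f lam (z k) - σ * ν ^ i * ‖etaZ k‖ ^ 2 ∧ i < Nmax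
  search_stop : ∀ k, k % N = 0 →
    ¬ (objective f lam (R (z k, ν ^ iter k • etaZ k)) >
      objective f lam (z k) - σ * ν ^ iter k * ‖etaZ k‖ ^ 2 ∧ iter k < Nmax)
  safeguard_effect : ∀ k, k % N = 0 →
    objective f lam (R (z k, ν ^ iter k • etaZ k)) < objective f lam (x k) →
    xs k = R (z k, ν ^ iter k • etaZ k) ∧ ys k = R (z k, ν ^ iter k • etaZ k) ∧ ts k = 1
  safeguard_keep : ∀ k, k % N = 0 →
    ¬ objective f lam (R (z k, ν ^ iter k • etaZ k)) < objective f lam (x k) →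
    xs k = x k ∧ ys k = y k ∧ ts k = t k
  z_next : ∀ k, k % N = 0 → z (k + N) = xs k
  -- no safeguard in the other iterations
  no_safeguard : ∀ k, k % N ≠ 0 → xs k = x k ∧ ys k = y k ∧ ts k = t k
  -- the accelerated proximal gradient step
  etaY_inexact : ∀ k, IsInexactDirection v f lam Lg μ B (ys k) (etaY k)
  etaY_mem : ∀ k, (ys k, etaY k) ∈ D
  x_next : ∀ k, x (k + 1) = R (ys k, etaY k)
  t_next : ∀ k, t (k + 1) = (Real.sqrt (4 * ts k ^ 2 + 1) + 1) / 2
  momentum_mem : ∀ k, (x (k + 1), ((1 - ts k) / t (k + 1)) •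
    (tangentSpace v (x (k + 1))).starProjection (xs k - x (k + 1))) ∈ D
  y_next : ∀ k, y (k + 1) = R (x (k + 1), ((1 - ts k) / t (k + 1)) •
    (tangentSpace v (x (k + 1))).starProjection (xs k - x (k + 1)))

/-- The line search of no safeguard step of the run fails; it fails when its counter reaches
`N_max`. -/
def AManPGRun.LineSearchNeverFails {n q : ℕ} {v : Fin n → ℝ} {f : MatSpace n q → ℝ} {lam Lg : ℝ}
    {D : Set (MatSpace n q × MatSpace n q)} {R : MatSpace n q × MatSpace n q → MatSpace n q}
    {B : NormalFrame q v} {μ σ ν : ℝ} {N Nmax : ℕ}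
    (r : AManPGRun v f lam Lg D R B μ σ ν N Nmax) : Prop :=
  ∀ k, k % N = 0 → r.iter k ≠ Nmax

/-- `z` is a stationary point of `F = f + g` on `𝓕_v`: `0 ∈ P_{T_z} ∂F(z)`. -/
def IsStationaryPoint {n q : ℕ} (v : Fin n → ℝ) (f : MatSpace n q → ℝ) (lam : ℝ) (z : MatSpace n q) :
    Prop :=
  z ∈ feasible q v ∧
    (0 : MatSpace n q) ∈ (tangentSpace v z).starProjection '' subdifferential (objective f lam) z

/-!
The manifold `𝓕_v` is compact, and this makes every constant below uniform.

Let `η` be an admissible direction at `x`, the tangential part of `p - x` for a proximal point `p`.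
The optimality condition at `p` provides a subgradient `ζ` of `g` at `p` whose tangential part is
`-grad f(x) - η / μ`. Testing it at `x`, and using that the accuracy condition bounds the normal
part of `p - x` by `s` with `s ^ 2 + 4 μ L_g s ≤ ‖η‖ ^ 2 / 2`, shows that the convex model decreases
by `3 ‖η‖ ^ 2 / (4 μ)` (`model_decrease`, `IsInexactDirection.exists_subgradient`). The retraction is
smooth near the compact zero section, so that `F (R_x(ξ))` exceeds the model at `ξ` by at most
`C ‖ξ‖ ^ 2` for small `ξ`, with one `C` for all `x` (`IsRetraction.exists_velocity_bound`,
`IsRetraction.exists_objective_le`). Admissible directions are bounded, hence all step sizes below a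
uniform threshold pass the line search (`IsRetraction.exists_sufficient_decrease`), which bounds the
number of backtracking steps.

If the line search never fails, `F (z_{(j + 1) N}) ≤ F (z_{j N}) - c ‖η_{z_{j N}}‖ ^ 2` with a fixed
`c > 0`: the safeguard never keeps an iterate worse than the one it tested, so the accelerated steps
between two safeguards are irrelevant. As `F` is bounded below on `𝓕_v`, the directions tend to
zero. Along an ultrafilter on which `z_{j N}` converges to `z_*`, the points `p` converge to `z_*` too
and the subgradients `ζ`, which are bounded by `L_g`, converge to a subgradient of `g` at `z_*`. The
tangent spaces are lower semicontinuous (`exists_continuous_tangent_field`), so the tangential part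
of `∇f + ζ`, which is `-η / μ`, vanishes in the limit (`isStationaryPoint_of_tendsto`).
-/

/-! ### Subgradients at proximal points -/

theorem IsProx.inner_le {n q : ℕ} {μ : ℝ} {g : MatSpace n q → ℝ} (hg : ConvexOn ℝ univ g)
    (hμ : 0 ≤ μ) {z p : MatSpace n q} (h : IsProx μ g z p) (w : MatSpace n q) :
    inner ℝ (z - p) (w - p) ≤ μ * (g w - g p) := by
  refine le_of_forall_pos_le_add fun δ hδ => ?_
  obtain ⟨t, ht0, ht1, htδ⟩ : ∃ t : ℝ, 0 < t ∧ t ≤ 1 ∧ t * (‖w - p‖ ^ 2 / 2) ≤ δ := by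
    refine ⟨min 1 (δ / (‖w - p‖ ^ 2 / 2 + 1)), by positivity, min_le_left _ _, ?_⟩
    calc _ ≤ δ / (‖w - p‖ ^ 2 / 2 + 1) * (‖w - p‖ ^ 2 / 2 + 1) :=
          mul_le_mul (min_le_right _ _) (by linarith) (by positivity) (by positivity)
      _ = δ := div_mul_cancel₀ _ (by positivity)
  have h1 := h (p + t • (w - p))
  have h2 := hg.2 (mem_univ p) (mem_univ w) (sub_nonneg.2 ht1) ht0.le (by ring)
  have e : (1 - t) • p + t • w = p + t • (w - p) := by rw [sub_smul, one_smul, smul_sub]; abel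
  have e2 : p + t • (w - p) - z = t • (w - p) - (z - p) := by abel
  rw [e, smul_eq_mul, smul_eq_mul] at h2
  rw [e2, norm_sub_sq_real (t • (w - p)), norm_sub_rev p z, norm_smul, inner_smul_left, mul_pow,
    Real.norm_eq_abs, sq_abs, real_inner_comm] at h1
  simp only [conj_trivial] at h1
  have h3 := mul_le_mul_of_nonneg_left h2 hμ
  have h4 : t * inner ℝ (z - p) (w - p) ≤ t * (μ * (g w - g p) + δ) := by
    nlinarith [mul_le_mul_of_nonneg_left htδ ht0.le]
  exact le_of_mul_le_mul_left h4 ht0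

/-- A subgradient of a Lipschitz function is bounded by the Lipschitz constant. -/
theorem norm_le_of_forall_inner_le {E : Type*} [NormedAddCommGroup E] [InnerProductSpace ℝ E]
    {g : E → ℝ} {L : NNReal} (hg : LipschitzWith L g) {ζ p : E}
    (h : ∀ w, inner ℝ ζ (w - p) ≤ g w - g p) : ‖ζ‖ ≤ L := by
  have h1 := h (p + ζ)
  have h2 := (le_abs_self _).trans (hg.norm_sub_le (p + ζ) p)
  rw [add_sub_cancel_left] at h1 h2
  rw [real_inner_self_eq_norm_sq] at h1
  by_contra! hc
  have : 0 < ‖ζ‖ := L.2.trans_lt hc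
  nlinarith

/-- The approximate direction `η = P_K (p - x)` decreases the convex model. The subgradient `ζ` at
`p` is tested at `x`: on `η` it equals `-G - η / μ`, and on the normal part `p - x - η` it is at most
`L ‖p - x - η‖`. Replacing `g p` by `g (x + η)` costs as much again, and `hs` bounds the total by
`‖η‖ ^ 2 / (4 μ)`. -/
theorem model_decrease {E : Type*} [NormedAddCommGroup E] [InnerProductSpace ℝ E]
    (K : Submodule ℝ E) [K.HasOrthogonalProjection] {g : E → ℝ} {L : NNReal}
    (hg : LipschitzWith L g) {μ : ℝ} (hμ : 0 < μ) {x p G b ζ : E} (hb : b ∈ Kᗮ)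
    (hζ : ζ = -(G - b) - μ⁻¹ • (p - x)) (h : ∀ w, inner ℝ ζ (w - p) ≤ g w - g p)
    (hs : ‖p - x - K.starProjection (p - x)‖ ^ 2 +
      4 * μ * L * ‖p - x - K.starProjection (p - x)‖ ≤ ‖K.starProjection (p - x)‖ ^ 2 / 2) :
    g (x + K.starProjection (p - x)) - g x + inner ℝ G (K.starProjection (p - x)) ≤
      -(3 / (4 * μ)) * ‖K.starProjection (p - x)‖ ^ 2 := by
  set η := K.starProjection (p - x) with hη
  set m := p - x - η with hm
  have hηK : η ∈ K := K.starProjection_apply_mem _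
  have hmK : m ∈ Kᗮ := K.sub_starProjection_mem_orthogonal _
  have hpx : p - x = η + m := by rw [hm]; abel
  have o1 : inner ℝ η m = 0 := hmK η hηK
  have o3 : inner ℝ η b = 0 := hb η hηK
  have hL := norm_le_of_forall_inner_le hg h
  have h1 := h x
  have e1 : x - p = -(η + m) := by rw [← hpx]; abel
  have o4 : inner ℝ m η = 0 := by rw [real_inner_comm]; exact o1
  have o5 : inner ℝ b η = 0 := by rw [real_inner_comm]; exact o3
  have h2 : inner ℝ ζ m ≤ L * ‖m‖ :=
    (real_inner_le_norm _ _).trans (mul_le_mul_of_nonneg_right hL (norm_nonneg _))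
  have h3 : g (x + η) - g p ≤ L * ‖m‖ := by
    have := (le_abs_self _).trans (hg.norm_sub_le (x + η) p)
    have e : x + η - p = -m := by rw [hm]; abel
    rwa [e, norm_neg] at this
  -- splitting `ζ` along `η + m`: the tangential part carries `G` and `η`
  have h4 : inner ℝ ζ (x - p) = inner ℝ G η + μ⁻¹ * ‖η‖ ^ 2 - inner ℝ ζ m := by
    rw [e1, inner_neg_right, inner_add_right]
    have : inner ℝ ζ η = -inner ℝ G η - μ⁻¹ * ‖η‖ ^ 2 := by
      rw [hζ, hpx, inner_sub_left, inner_neg_left, inner_sub_left, inner_smul_left,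
        inner_add_left, o4, o5, real_inner_self_eq_norm_sq]
      simp
    rw [this]; ring
  rw [h4] at h1
  have h5 : 2 * (L * ‖m‖) ≤ 1 / (4 * μ) * ‖η‖ ^ 2 := by
    rw [div_mul_eq_mul_div, le_div_iff₀ (by positivity)]
    nlinarith [sq_nonneg ‖m‖]
  have h6 : -(3 / (4 * μ)) * ‖η‖ ^ 2 = 1 / (4 * μ) * ‖η‖ ^ 2 - μ⁻¹ * ‖η‖ ^ 2 := by
    field_simp; ring
  rw [h6]
  linarith

theorem convexOn_regularizer {n q : ℕ} {lam : ℝ} (hlam : 0 ≤ lam) :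
    ConvexOn ℝ univ (regularizer lam : MatSpace n q → ℝ) := by
  refine ⟨convex_univ, fun x _ y _ a b ha hb _ => ?_⟩
  have h : l1Norm (a • x + b • y) ≤ a * l1Norm x + b * l1Norm y := by
    simp only [l1Norm, Finset.mul_sum, ← Finset.sum_add_distrib]
    refine Finset.sum_le_sum fun p _ => ?_
    refine (abs_add_le _ _).trans (le_of_eq ?_)
    simp [abs_mul, abs_of_nonneg ha, abs_of_nonneg hb]
  simp only [regularizer, smul_eq_mul]
  nlinarith [mul_le_mul_of_nonneg_left h hlam]

theorem normalMap_mem {n q : ℕ} {v : Fin n → ℝ} (B : NormalFrame q v) (x : MatSpace n q)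
    (u : EuclideanSpace ℝ (Fin (Module.finrank ℝ (tangentSpace v x)ᗮ))) :
    normalMap B x u ∈ (tangentSpace v x)ᗮ :=
  ((B x).repr.symm u).2

theorem norm_sub_starProjection_le_norm_adjoint {n q : ℕ} {v : Fin n → ℝ} (B : NormalFrame q v)
    (x w : MatSpace n q) :
    ‖w - (tangentSpace v x).starProjection w‖ ≤ ‖(normalMap B x).adjoint w‖ := by
  set T := tangentSpace v x
  set m := w - T.starProjection w with hm
  have hmT : m ∈ Tᗮ := T.sub_starProjection_mem_orthogonal _
  set u := (B x).repr ⟨m, hmT⟩ with hu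
  have h1 : normalMap B x u = m := by simp [normalMap, hu]
  have h2 : ‖u‖ = ‖m‖ := by rw [hu, LinearIsometryEquiv.norm_map]; rfl
  have h3 : inner ℝ m w = ‖m‖ ^ 2 := by
    have e : w = T.starProjection w + m := by rw [hm]; abel
    have o : inner ℝ m (T.starProjection w) = 0 := by
      rw [real_inner_comm]; exact hmT _ (T.starProjection_apply_mem _)
    conv_lhs => rw [e, inner_add_right, o, zero_add, real_inner_self_eq_norm_sq]
  have h4 : ‖m‖ ^ 2 ≤ ‖m‖ * ‖(normalMap B x).adjoint w‖ := by
    rw [← h3, ← h1, ← ContinuousLinearMap.adjoint_inner_right, h1, ← h2]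
    exact real_inner_le_norm _ _
  rcases (norm_nonneg m).eq_or_lt with h | h
  · rw [← h]; exact norm_nonneg _
  · nlinarith

/-- What the convergence proof uses of an admissible direction `η`: a subgradient `ζ` of `g` at a
point `p` near `x + η`, whose tangential part is `-grad f(x) - η / μ`. -/
theorem IsInexactDirection.exists_subgradient {n q : ℕ} {v : Fin n → ℝ} {f : MatSpace n q → ℝ}
    {lam μ : ℝ} {Lg : NNReal} {B : NormalFrame q v} {x η : MatSpace n q} (hlam : 0 ≤ lam)
    (hμ : 0 < μ) (hLg : LipschitzWith Lg (regularizer lam : MatSpace n q → ℝ))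
    (h : IsInexactDirection v f lam Lg μ B x η) :
    η ∈ tangentSpace v x ∧ ∃ p ζ : MatSpace n q,
      (∀ w, inner ℝ ζ (w - p) ≤ regularizer lam w - regularizer lam p) ∧
      (∀ τ ∈ tangentSpace v x, inner ℝ (ζ + gradient f x) τ = -(μ⁻¹ * inner ℝ η τ)) ∧
      ‖p - x - η‖ ≤ ‖η‖ ∧
      regularizer lam (x + η) - regularizer lam x + inner ℝ (gradient f x) η ≤
        -(3 / (4 * μ)) * ‖η‖ ^ 2 := by
  obtain ⟨Λ, p, hp, hη, hΨ⟩ := h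
  have hηT : η ∈ tangentSpace v x := hη ▸ (tangentSpace v x).starProjection_apply_mem _
  set b := normalMap B x Λ
  have hb : b ∈ (tangentSpace v x)ᗮ := normalMap_mem B x Λ
  set ζ : MatSpace n q := -(riemGrad v f x - b) - μ⁻¹ • (p - x) with hζ
  have hsub : ∀ w, inner ℝ ζ (w - p) ≤ regularizer lam w - regularizer lam p := by
    intro w
    have h1 := hp.inner_le (convexOn_regularizer hlam) hμ.le w
    have e : x - μ • (riemGrad v f x - b) - p = μ • ζ := by
      rw [hζ, smul_sub μ (-_), smul_smul, mul_inv_cancel₀ hμ.ne', one_smul, smul_neg]; abel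
    rw [e, inner_smul_left] at h1
    exact le_of_mul_le_mul_left h1 hμ
  have hm := (norm_sub_starProjection_le_norm_adjoint B x (p - x)).trans hΨ
  have hs : ‖p - x - (tangentSpace v x).starProjection (p - x)‖ ^ 2 +
      4 * μ * Lg * ‖p - x - (tangentSpace v x).starProjection (p - x)‖ ≤
        ‖(tangentSpace v x).starProjection (p - x)‖ ^ 2 / 2 := by
    rw [← hη] at hm ⊢
    have hq := Real.sq_sqrt (show 0 ≤ 4 * μ ^ 2 * (Lg : ℝ) ^ 2 + ‖η‖ ^ 2 / 2 by positivity)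
    have h0 : 0 ≤ 2 * μ * (Lg : ℝ) := by positivity
    have h2 : (‖p - x - η‖ + 2 * μ * Lg) ^ 2 ≤ 4 * μ ^ 2 * (Lg : ℝ) ^ 2 + ‖η‖ ^ 2 / 2 := by
      rw [← hq]
      exact pow_le_pow_left₀ (by positivity) (by linarith) 2
    nlinarith
  have hgr : ∀ τ ∈ tangentSpace v x, 
      inner ℝ (riemGrad v f x) τ = inner ℝ (gradient f x) τ := fun τ hτ => by
    rw [riemGrad, (tangentSpace v x).inner_starProjection_left_eq_right,
      (tangentSpace v x).starProjection_eq_self_iff.2 hτ]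
  refine ⟨hηT, p, ζ, hsub, fun τ hτ => ?_, ?_, ?_⟩
  · have h1 : inner ℝ b τ = 0 := by rw [real_inner_comm]; exact hb τ hτ
    have h2 : inner ℝ (p - x) τ = inner ℝ η τ := by
      rw [hη, (tangentSpace v x).inner_starProjection_left_eq_right,
      (tangentSpace v x).starProjection_eq_self_iff.2 hτ]
    rw [hζ, inner_add_left, inner_sub_left, inner_neg_left, inner_sub_left, h1, inner_smul_left,
      h2, hgr τ hτ]
    simp only [conj_trivial]
    ring
  · rw [← hη] at hs
    have h0 : 0 ≤ 4 * μ * Lg * ‖p - x - η‖ := by positivity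
    nlinarith [norm_nonneg η, norm_nonneg (p - x - η)]
  · have := model_decrease (tangentSpace v x) hLg hμ hb hζ hsub hs
    rw [← hη] at this
    rwa [← hgr η hηT]

/-! ### Regularity of the retraction and geometry of the manifold -/

/-- A function that is twice continuously differentiable within `s` at `x₀` has, near `x₀` in `s`, a
derivative whose variation along segments contained in `s` is Lipschitz. The set `s` is not
required to have unique derivatives. -/
theorem ContDiffWithinAt.exists_fderiv_lipschitz_on_segments {E F : Type*} [NormedAddCommGroup E]
    [NormedSpace ℝ E] [NormedAddCommGroup F] [NormedSpace ℝ F] {f : E → F} {s : Set E} {x₀ : E}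
    (hf : ContDiffWithinAt ℝ 2 f s x₀) (hx₀ : x₀ ∈ s) :
    ∃ δ > 0, ∃ C ≥ 0, ∃ f' : E → E →L[ℝ] F,
      (∀ x ∈ s ∩ Metric.ball x₀ δ, HasFDerivWithinAt f (f' x) (s ∩ Metric.ball x₀ δ) x) ∧
      ∀ a b, segment ℝ a b ⊆ s ∩ Metric.ball x₀ δ → ‖f' b - f' a‖ ≤ C * ‖b - a‖ := by
  obtain ⟨u, hu, -, f', hf', hc⟩ :=
    (contDiffWithinAt_succ_iff_hasFDerivWithinAt (n := 1) (by simp)).1 hf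
  rw [insert_eq_of_mem hx₀] at hu
  have hxu : x₀ ∈ u := mem_of_mem_nhdsWithin hx₀ hu
  obtain ⟨w, hw, -, f'', hf'', hc''⟩ :=
    (contDiffWithinAt_succ_iff_hasFDerivWithinAt (n := 0) (by simp)).1 hc
  rw [insert_eq_of_mem hxu] at hw
  have hb : ∀ᶠ x in 𝓝[w] x₀, ‖f'' x‖ < ‖f'' x₀‖ + 1 :=
    hc''.continuousWithinAt.norm.eventually_lt_const (lt_add_one _)
  have hsu : 𝓝[s] x₀ ≤ 𝓝[u] x₀ := nhdsWithin_le_iff.2 hu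
  have hall : u ∩ w ∩ {x | ‖f'' x‖ < ‖f'' x₀‖ + 1} ∈ 𝓝[s] x₀ :=
    inter_mem (inter_mem hu (hsu hw)) (hsu (nhdsWithin_le_iff.2 hw hb))
  obtain ⟨δ, hδ, hsub⟩ := Metric.mem_nhdsWithin_iff.1 hall
  rw [inter_comm] at hsub
  refine ⟨δ, hδ, ‖f'' x₀‖ + 1, by positivity, f',
    fun x hx => (hf' x (hsub hx).1.1).mono fun y hy => (hsub hy).1.1, fun a b hab => ?_⟩
  exact Convex.norm_image_sub_le_of_norm_hasFDerivWithin_le (s := segment ℝ a b)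
    (fun x hx => (hf'' x (hsub (hab hx)).1.2).mono fun y hy => (hsub (hab hy)).1.2)
    (fun x hx => (hsub (hab hx)).2.le) (convex_segment a b) (left_mem_segment ℝ a b)
    (right_mem_segment ℝ a b)

/-- Near a point of the manifold, the velocity of `t ↦ R_x(t η)`, `0 ≤ t ≤ 1`, differs from `η` by
`O(‖η‖ ^ 2)`. -/
theorem IsRetraction.exists_local_velocity_bound {n q : ℕ} {v : Fin n → ℝ}
    {D : Set (MatSpace n q × MatSpace n q)} {R : MatSpace n q × MatSpace n q → MatSpace n q}
    (hR : IsRetraction v D R) {x₀ : MatSpace n q} (hx₀ : x₀ ∈ feasible q v) :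
    ∃ δ > 0, ∃ C ≥ 0, ∀ x ∈ feasible q v, x ∈ Metric.ball x₀ δ → ∀ η ∈ tangentSpace v x,
      ‖η‖ < δ → (∀ t ∈ Icc (0 : ℝ) 1, (x, t • η) ∈ D) ∧ ∃ φ' : ℝ → MatSpace n q,
        ∀ t ∈ Icc (0 : ℝ) 1,
          HasDerivWithinAt (fun s : ℝ => R (x, s • η)) (φ' t) (Icc 0 1) t ∧
          ‖φ' t - η‖ ≤ C * ‖η‖ ^ 2 := by
  have h0 := hR.zero_mem x₀ hx₀
  have hsmooth : ContDiffOn ℝ 2 R D :=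
    hR.smooth.of_le (WithTop.coe_le_coe.2 (le_top : (2 : ℕ∞) ≤ ⊤))
  obtain ⟨δ, hδ, C, hC, R', hR', hseg⟩ :=
    (hsmooth (x₀, 0) h0).exists_fderiv_lipschitz_on_segments h0
  obtain ⟨U, hU, hDU⟩ := hR.isOpen_domain
  obtain ⟨δ', hδ', hball⟩ := Metric.isOpen_iff.1 hU (x₀, 0) (hDU ▸ h0 : _ ∈ _ ∩ U).2
  refine ⟨min δ δ', lt_min hδ hδ', C, hC, fun x hx hxd η hη hηd => ?_⟩
  have hb : ∀ r, min δ δ' ≤ r → ∀ t ∈ Icc (0 : ℝ) 1, (x, t • η) ∈ Metric.ball (x₀, 0) r := by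
    intro r hr t ht
    rw [← ball_prod_same]
    refine ⟨Metric.ball_subset_ball hr hxd, ?_⟩
    rw [mem_ball_zero_iff, norm_smul, Real.norm_eq_abs, abs_of_nonneg ht.1]
    calc t * ‖η‖ ≤ 1 * ‖η‖ := mul_le_mul_of_nonneg_right ht.2 (norm_nonneg _)
      _ < r := by rw [one_mul]; exact hηd.trans_le hr
  have hD : ∀ t ∈ Icc (0 : ℝ) 1, (x, t • η) ∈ D := fun t ht => by
    rw [hDU]
    exact ⟨⟨hx, (tangentSpace v x).smul_mem t hη⟩, hball (hb δ' (min_le_right _ _) t ht)⟩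
  have hDb : ∀ t ∈ Icc (0 : ℝ) 1, (x, t • η) ∈ D ∩ Metric.ball (x₀, 0) δ := fun t ht =>
    ⟨hD t ht, hb δ (min_le_left _ _) t ht⟩
  have hder : ∀ t ∈ Icc (0 : ℝ) 1, HasDerivWithinAt (fun s : ℝ => R (x, s • η))
      (R' (x, t • η) (0, η)) (Icc 0 1) t := by
    intro t ht
    have h1 : HasDerivWithinAt (fun s : ℝ => (x, s • η)) ((0 : MatSpace n q), η) (Icc 0 1) t := by
      have := ((hasDerivAt_id t).smul_const η).hasDerivWithinAt (s := Icc 0 1)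
      simp only [id, one_smul] at this
      exact (hasDerivWithinAt_const t (Icc (0 : ℝ) 1) x).prodMk this
    exact (hR' _ (hDb t ht)).comp_hasDerivWithinAt t h1 fun s hs => hDb s hs
  have hzero : (0 : ℝ) ∈ Icc (0 : ℝ) 1 := ⟨le_rfl, zero_le_one⟩
  have hη0 : R' (x, (0 : ℝ) • η) (0, η) = η :=
    (uniqueDiffOn_Icc_zero_one 0 hzero).eq_deriv _ (hder 0 hzero)
      (hR.hasDerivAt (x, η) ⟨hx, hη⟩).hasDerivWithinAt
  refine ⟨hD, fun t => R' (x, t • η) (0, η), fun t ht => ⟨hder t ht, ?_⟩⟩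
  have hs := hseg (x, (0 : ℝ) • η) (x, t • η) (by
    rintro _ ⟨a, b, ha, hb', hab, rfl⟩
    have e : a • (x, (0 : ℝ) • η) + b • (x, t • η) = (x, (b * t) • η) := by
      ext1
      · simp [← add_smul, hab]
      · simp [smul_smul]
    rw [e]
    exact hDb _ ⟨mul_nonneg hb' ht.1, by nlinarith [ht.1, ht.2]⟩)
  have e1 : ‖((x, t • η) : MatSpace n q × MatSpace n q) - (x, (0 : ℝ) • η)‖ ≤ ‖η‖ := by
    simp only [zero_smul, Prod.mk_sub_mk, sub_self, sub_zero, Prod.norm_mk, norm_zero, norm_smul,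
      Real.norm_eq_abs, abs_of_nonneg ht.1]
    exact max_le (norm_nonneg _) (mul_le_of_le_one_left (norm_nonneg _) ht.2)
  have e2 : ‖((0 : MatSpace n q), η)‖ = ‖η‖ := by simp [Prod.norm_mk]
  calc ‖R' (x, t • η) (0, η) - η‖
      = ‖(R' (x, t • η) - R' (x, (0 : ℝ) • η)) (0, η)‖ := by
        rw [sub_apply, hη0]
    _ ≤ C * ‖η‖ * ‖η‖ := by
        refine (ContinuousLinearMap.le_opNorm _ _).trans ?_
        rw [e2]
        exact mul_le_mul_of_nonneg_right (hs.trans (mul_le_mul_of_nonneg_left e1 hC))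
          (norm_nonneg _)
    _ = C * ‖η‖ ^ 2 := by ring

theorem mem_feasible_iff {n q : ℕ} {v : Fin n → ℝ} {x : MatSpace n q} :
    x ∈ feasible q v ↔ (toMat x).transpose * toMat x = 1 ∧
      (toMat x).mulVec ((toMat x).transpose.mulVec v) = v :=
  ⟨fun h => ⟨h.1, mul_transpose_mulVec_of_mem h⟩, fun h => ⟨h.1, _, h.2⟩⟩

theorem continuous_toMat {n q : ℕ} : Continuous (toMat : MatSpace n q → _) := by
  unfold toMat
  fun_prop

theorem isCompact_feasible {n q : ℕ} (v : Fin n → ℝ) : IsCompact (feasible q v) := by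
  refine Metric.isCompact_of_isClosed_isBounded ?_ ?_
  · have : feasible q v = {x | (toMat x).transpose * toMat x = 1} ∩
        {x | (toMat x).mulVec ((toMat x).transpose.mulVec v) = v} := by
      ext x; exact mem_feasible_iff
    rw [this]
    have hc := continuous_toMat (n := n) (q := q)
    exact (isClosed_eq (hc.matrix_transpose.matrix_mul hc) continuous_const).inter
      (isClosed_eq (hc.matrix_mulVec (hc.matrix_transpose.matrix_mulVec continuous_const))
        continuous_const)
  · refine isBounded_iff_forall_norm_le.2 ⟨Real.sqrt q, fun x hx => Real.le_sqrt_of_sq_le ?_⟩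
    have h := congrArg Matrix.trace hx.1
    rw [Matrix.trace_one, Fintype.card_fin] at h
    rw [EuclideanSpace.norm_sq_eq, ← h, Fintype.sum_prod_type_right]
    simp [Matrix.trace, Matrix.mul_apply, toMat, sq]

/-- The velocity bound with constants that are uniform over the compact manifold. -/
theorem IsRetraction.exists_velocity_bound {n q : ℕ} {v : Fin n → ℝ}
    {D : Set (MatSpace n q × MatSpace n q)} {R : MatSpace n q × MatSpace n q → MatSpace n q}
    (hR : IsRetraction v D R) :
    ∃ δ > 0, ∃ C ≥ 0, ∀ x ∈ feasible q v, ∀ η ∈ tangentSpace v x,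
      ‖η‖ < δ → (∀ t ∈ Icc (0 : ℝ) 1, (x, t • η) ∈ D) ∧ ∃ φ' : ℝ → MatSpace n q,
        ∀ t ∈ Icc (0 : ℝ) 1,
          HasDerivWithinAt (fun s : ℝ => R (x, s • η)) (φ' t) (Icc 0 1) t ∧
          ‖φ' t - η‖ ≤ C * ‖η‖ ^ 2 := by
  refine (isCompact_feasible v).induction_on (p := fun S => ∃ δ > 0, ∃ C ≥ 0, ∀ x ∈ S,
    ∀ η ∈ tangentSpace v x,
      ‖η‖ < δ → (∀ t ∈ Icc (0 : ℝ) 1, (x, t • η) ∈ D) ∧ ∃ φ' : ℝ → MatSpace n q,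
        ∀ t ∈ Icc (0 : ℝ) 1,
          HasDerivWithinAt (fun s : ℝ => R (x, s • η)) (φ' t) (Icc 0 1) t ∧
          ‖φ' t - η‖ ≤ C * ‖η‖ ^ 2) ⟨1, one_pos, 0, le_rfl, by simp⟩ ?_ ?_ ?_
  · rintro S S' hS ⟨δ, hδ, C, hC, h⟩
    exact ⟨δ, hδ, C, hC, fun x hx => h x (hS hx)⟩
  · rintro S S' ⟨δ, hδ, C, hC, h⟩ ⟨δ', hδ', C', hC', h'⟩
    refine ⟨min δ δ', lt_min hδ hδ', max C C', le_max_of_le_left hC, fun x hx η hη hd => ?_⟩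
    rcases hx with hx | hx
    · obtain ⟨h1, φ', h2⟩ := h x hx η hη (hd.trans_le (min_le_left _ _))
      exact ⟨h1, φ', fun t ht => ⟨(h2 t ht).1, (h2 t ht).2.trans
        (mul_le_mul_of_nonneg_right (le_max_left _ _) (sq_nonneg _))⟩⟩
    · obtain ⟨h1, φ', h2⟩ := h' x hx η hη (hd.trans_le (min_le_right _ _))
      exact ⟨h1, φ', fun t ht => ⟨(h2 t ht).1, (h2 t ht).2.trans
        (mul_le_mul_of_nonneg_right (le_max_right _ _) (sq_nonneg _))⟩⟩
  · intro x₀ hx₀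
    obtain ⟨δ, hδ, C, hC, h⟩ := hR.exists_local_velocity_bound hx₀
    exact ⟨feasible q v ∩ Metric.ball x₀ δ,
      inter_mem_nhdsWithin _ (Metric.ball_mem_nhds x₀ hδ), δ, hδ, C, hC,
      fun x hx => h x hx.1 hx.2⟩

/-- Tangent spaces vary lower semicontinuously: every vector tangent at `x` is the value at `x` of a
continuous field of tangent vectors. -/
theorem exists_continuous_tangent_field {n q : ℕ} {v : Fin n → ℝ} {x τ : MatSpace n q}
    (hx : x ∈ feasible q v) (hτ : τ ∈ tangentSpace v x) :
    ∃ W : MatSpace n q → MatSpace n q, Continuous W ∧ W x = τ ∧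
      ∀ y ∈ feasible q v, W y ∈ tangentSpace v y := by
  set X := toMat x with hX
  set H := toMat τ with hH
  set Ω := X.transpose * H with hΩ
  set K := H - X * Ω with hK
  obtain ⟨h1, h2⟩ := hτ
  have hΩs : Ω.transpose = -Ω := by
    rw [hΩ, Matrix.transpose_mul, Matrix.transpose_transpose]
    exact eq_neg_of_add_eq_zero_right h1
  -- `x Ω + K` with `Ω` skew, `K` normal to the columns and killing `xᵀ v`; at `y`, project `K`
  -- to these two conditions. If `v = 0`, the division by zero makes the second projection trivial.
  let G : MatSpace n q → Matrix (Fin n) (Fin q) ℝ := fun y =>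
    let a := (toMat y).transpose.mulVec v
    let K' := K - (toMat y) * ((toMat y).transpose * K)
    toMat y * Ω + (K' - (v ⬝ᵥ v)⁻¹ • (Matrix.vecMulVec (K'.mulVec a) a))
  have hXX : X.transpose * X = 1 := hx.1
  have hdot : ∀ y ∈ feasible q v, ((toMat y).transpose.mulVec v) ⬝ᵥ
      ((toMat y).transpose.mulVec v) = v ⬝ᵥ v := by
    intro y hy
    conv_rhs => rw [← mul_transpose_mulVec_of_mem hy]
    conv_rhs => enter [2]; rw [mul_transpose_mulVec_of_mem hy]
    rw [Matrix.mulVec_transpose, ← Matrix.dotProduct_mulVec, dotProduct_comm,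
      ← Matrix.mulVec_transpose]
  refine ⟨fun y => WithLp.toLp 2 fun p => G y p.1 p.2, ?_, ?_, fun y hy => ?_⟩
  · have hc := continuous_toMat (n := n) (q := q)
    have hG : Continuous G := by
      have ha : Continuous fun y : MatSpace n q => (toMat y).transpose.mulVec v :=
        hc.matrix_transpose.matrix_mulVec continuous_const
      have hK' : Continuous fun y : MatSpace n q =>
          K - (toMat y) * ((toMat y).transpose * K) :=
        continuous_const.sub (hc.matrix_mul (hc.matrix_transpose.matrix_mul continuous_const))
      have h := (hK'.matrix_mulVec ha).matrix_vecMulVec ha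
      exact (hc.matrix_mul continuous_const).add
        (hK'.sub (h.const_smul (v ⬝ᵥ v)⁻¹))
    exact (PiLp.continuous_toLp 2 _).comp
      (continuous_pi fun p => hG.matrix_elem p.1 p.2)
  · have hKX : X.transpose * K = 0 := by
      rw [hK, Matrix.mul_sub, ← Matrix.mul_assoc, hXX, Matrix.one_mul, hΩ, sub_self]
    have : G x = H := by
      simp only [G]
      rw [← hX, hKX, Matrix.mul_zero, sub_zero, h2, Matrix.zero_vecMulVec, smul_zero, sub_zero,
        hK, add_sub_cancel]
    ext p
    show G x p.1 p.2 = τ p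
    rw [this]; rfl
  · set Y := toMat y with hY
    have hYY : Y.transpose * Y = 1 := hy.1
    set a := Y.transpose.mulVec v with ha
    set K' := K - Y * (Y.transpose * K) with hK'
    set Z := K' - (v ⬝ᵥ v)⁻¹ • (Matrix.vecMulVec (K'.mulVec a) a) with hZ
    have hG : G y = Y * Ω + Z := rfl
    have hYK : Y.transpose * K' = 0 := by
      rw [hK', Matrix.mul_sub, ← Matrix.mul_assoc, hYY, Matrix.one_mul, sub_self]
    have hYZ : Y.transpose * Z = 0 := by
      rw [hZ, Matrix.mul_sub, hYK, Matrix.mul_smul, Matrix.mul_vecMulVec, Matrix.mulVec_mulVec,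
        hYK, Matrix.zero_mulVec, Matrix.zero_vecMulVec, smul_zero, sub_zero]
    have hZY : Z.transpose * Y = 0 := by
      have := congrArg Matrix.transpose hYZ
      simpa [Matrix.transpose_mul] using this
    have hYG : Y.transpose * (Y * Ω + Z) = Ω := by
      rw [Matrix.mul_add, ← Matrix.mul_assoc, hYY, Matrix.one_mul, hYZ, add_zero]
    have hZa : Z.mulVec a = 0 := by
      rw [hZ, Matrix.sub_mulVec, Matrix.smul_mulVec, Matrix.vecMulVec_mulVec, hdot y hy]
      by_cases hv : v ⬝ᵥ v = 0
      · have : a = 0 := dotProduct_self_eq_zero.1 ((hdot y hy).trans hv)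
        simp [this]
      · ext i
        simp [hv]
    refine ⟨?_, ?_⟩
    · show Y.transpose * G y + (G y).transpose * Y = 0
      rw [hG, hYG, Matrix.transpose_add, Matrix.add_mul, hZY, Matrix.transpose_mul, hΩs,
        Matrix.mul_assoc, hYY, Matrix.mul_one, add_zero, add_neg_cancel]
    · show (G y - Y * (Y.transpose * G y)).mulVec a = 0
      rw [hG, hYG, add_sub_cancel_left, hZa]

/-! ### Decrease of the objective -/

theorem exists_gradient_bound {n q : ℕ} {v : Fin n → ℝ} {f : MatSpace n q → ℝ} {Lf : NNReal}
    (hLf : LipschitzOnWith Lf (gradient f) (feasible q v)) :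
    ∃ G ≥ 0, ∀ x ∈ feasible q v, ‖gradient f x‖ ≤ G := by
  obtain ⟨G, hG⟩ := (isCompact_feasible v).exists_bound_of_continuousOn hLf.continuousOn
  exact ⟨max G 0, le_max_right _ _, fun x hx => (hG x hx).trans (le_max_left _ _)⟩

/-- A second order upper model of `F` along the retraction. Since `f` is controlled on the manifold
only, it is estimated along the curve `t ↦ R_x(t ξ)`, which stays in the manifold. -/
theorem IsRetraction.exists_objective_le {n q : ℕ} {v : Fin n → ℝ}
    {D : Set (MatSpace n q × MatSpace n q)} {R : MatSpace n q × MatSpace n q → MatSpace n q}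
    (hR : IsRetraction v D R) {f : MatSpace n q → ℝ}
    (hf : ∀ x ∈ feasible q v, DifferentiableAt ℝ f x) {Lf : NNReal}
    (hLf : LipschitzOnWith Lf (gradient f) (feasible q v)) {lam : ℝ} {Lg : NNReal}
    (hLg : LipschitzWith Lg (regularizer lam : MatSpace n q → ℝ)) :
    ∃ δ > 0, ∃ C ≥ 0, ∀ x ∈ feasible q v, ∀ ξ ∈ tangentSpace v x, ‖ξ‖ < δ →
      objective f lam (R (x, ξ)) ≤
        f x + inner ℝ (gradient f x) ξ + regularizer lam (x + ξ) + C * ‖ξ‖ ^ 2 := by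
  obtain ⟨δ, hδ, C, hC, h⟩ := hR.exists_velocity_bound
  obtain ⟨G, hG0, hG⟩ := exists_gradient_bound hLf
  refine ⟨min δ 1, lt_min hδ one_pos, Lf * (1 + C) ^ 2 + G * C + Lg * C, by positivity,
    fun x hx ξ hξ hξδ => ?_⟩
  obtain ⟨hD, φ', hφ⟩ := h x hx ξ hξ (hξδ.trans_le (min_le_left _ _))
  have hξ1 : ‖ξ‖ ≤ 1 := (hξδ.trans_le (min_le_right _ _)).le
  set φ : ℝ → MatSpace n q := fun s => R (x, s • ξ) with hφdef
  have hφ0 : φ 0 = x := by simp [hφdef, hR.map_zero x hx]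
  have hφ1 : φ 1 = R (x, ξ) := by simp [hφdef]
  have hφM : ∀ t ∈ Icc (0 : ℝ) 1, φ t ∈ feasible q v := fun t ht => hR.mapsTo _ (hD t ht)
  have h0 : (0 : ℝ) ∈ Icc (0 : ℝ) 1 := ⟨le_rfl, zero_le_one⟩
  have h1 : (1 : ℝ) ∈ Icc (0 : ℝ) 1 := ⟨zero_le_one, le_rfl⟩
  have hφ' : ∀ t ∈ Icc (0 : ℝ) 1, ‖φ' t‖ ≤ (1 + C) * ‖ξ‖ := fun t ht => by
    have e : φ' t = φ' t - ξ + ξ := by abel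
    have h2 := (hφ t ht).2
    have h3 : C * ‖ξ‖ ^ 2 ≤ C * ‖ξ‖ :=
      mul_le_mul_of_nonneg_left (by nlinarith [norm_nonneg ξ]) hC
    rw [e]
    linarith [norm_add_le (φ' t - ξ) ξ]
  have hφx : ∀ t ∈ Icc (0 : ℝ) 1, ‖φ t - x‖ ≤ (1 + C) * ‖ξ‖ := fun t ht => by
    have h2 := (convex_Icc (0 : ℝ) 1).norm_image_sub_le_of_norm_hasDerivWithin_le
      (fun s hs => (hφ s hs).1) hφ' h0 ht
    rw [hφ0, sub_zero, Real.norm_eq_abs, abs_of_nonneg ht.1] at h2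
    exact h2.trans (mul_le_of_le_one_right (by positivity) ht.2)
  have hsecond : ‖φ 1 - (x + ξ)‖ ≤ C * ‖ξ‖ ^ 2 := by
    have h2 := (convex_Icc (0 : ℝ) 1).norm_image_sub_le_of_norm_hasDerivWithin_le
      (f := fun s => φ s - s • ξ) (f' := fun s => φ' s - ξ) (fun s hs => by
        have := (hφ s hs).1.sub ((hasDerivAt_id s).smul_const ξ).hasDerivWithinAt
        simpa using! this) (fun s hs => (hφ s hs).2) h0 h1
    simp only [one_smul, zero_smul, sub_zero, hφ0, norm_one, mul_one] at h2
    rwa [sub_sub, add_comm ξ x] at h2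
  have hfd : ∀ t ∈ Icc (0 : ℝ) 1, HasDerivWithinAt (fun s => f (φ s) - s * inner ℝ (gradient f x) ξ)
      (inner ℝ (gradient f (φ t)) (φ' t) - inner ℝ (gradient f x) ξ) (Icc 0 1) t := by
    intro t ht
    have h2 := (hf _ (hφM t ht)).hasGradientAt.hasFDerivAt.comp_hasDerivWithinAt t (hφ t ht).1
    have h3 := ((hasDerivAt_id t).mul_const (inner ℝ (gradient f x) ξ)).hasDerivWithinAt
      (s := Icc 0 1)
    have := h2.sub h3
    simpa using! this
  have hf1 : f (φ 1) - f x - inner ℝ (gradient f x) ξ ≤ (Lf * (1 + C) ^ 2 + G * C) * ‖ξ‖ ^ 2 := by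
    have h2 := (convex_Icc (0 : ℝ) 1).norm_image_sub_le_of_norm_hasDerivWithin_le hfd
      (C := (Lf * (1 + C) ^ 2 + G * C) * ‖ξ‖ ^ 2) (fun t ht => by
        have e : inner ℝ (gradient f (φ t)) (φ' t) - inner ℝ (gradient f x) ξ =
            inner ℝ (gradient f (φ t) - gradient f x) (φ' t) +
              inner ℝ (gradient f x) (φ' t - ξ) := by
          rw [inner_sub_left, inner_sub_right]; ring
        rw [e]
        refine (norm_add_le _ _).trans ?_
        have a1 : ‖gradient f (φ t) - gradient f x‖ ≤ Lf * ((1 + C) * ‖ξ‖) :=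
          (hLf.norm_sub_le (hφM t ht) hx).trans (mul_le_mul_of_nonneg_left (hφx t ht) Lf.2)
        have a2 := (norm_inner_le_norm (𝕜 := ℝ) (gradient f (φ t) - gradient f x) (φ' t)).trans
          (mul_le_mul a1 (hφ' t ht) (norm_nonneg _) (by positivity))
        have a3 := (norm_inner_le_norm (𝕜 := ℝ) (gradient f x) (φ' t - ξ)).trans
          (mul_le_mul (hG x hx) (hφ t ht).2 (norm_nonneg _) hG0)
        linarith) h0 h1
    simp only [hφ0, one_mul, zero_mul, sub_zero, norm_one, mul_one] at h2
    have := (le_abs_self _).trans h2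
    linarith
  have hg1 : regularizer lam (φ 1) - regularizer lam (x + ξ) ≤ Lg * (C * ‖ξ‖ ^ 2) :=
    ((le_abs_self _).trans (hLg.norm_sub_le _ _)).trans (mul_le_mul_of_nonneg_left hsecond Lg.2)
  rw [objective, ← hφ1]
  linarith

/-- The line search condition holds for all step sizes up to a threshold that is independent of the
point, the direction and the normal frame. -/
theorem IsRetraction.exists_sufficient_decrease {n q : ℕ} {v : Fin n → ℝ}
    {D : Set (MatSpace n q × MatSpace n q)} {R : MatSpace n q × MatSpace n q → MatSpace n q}
    (hR : IsRetraction v D R) {f : MatSpace n q → ℝ}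
    (hf : ∀ x ∈ feasible q v, DifferentiableAt ℝ f x) {Lf : NNReal}
    (hLf : LipschitzOnWith Lf (gradient f) (feasible q v)) {lam : ℝ} (hlam : 0 ≤ lam)
    {Lg : NNReal} (hLg : LipschitzWith Lg (regularizer lam : MatSpace n q → ℝ))
    {μ σ : ℝ} (hμ : 0 < μ) (hσ : σ ≤ 1 / (8 * μ)) :
    ∃ α₀ > 0, ∀ (B : NormalFrame q v), ∀ x ∈ feasible q v, ∀ η,
      IsInexactDirection v f lam Lg μ B x η → ∀ α, 0 < α → α ≤ α₀ →
        objective f lam (R (x, α • η)) ≤ objective f lam x - σ * α * ‖η‖ ^ 2 := by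
  obtain ⟨δ, hδ, C, hC, h⟩ := hR.exists_objective_le hf hLf hLg
  obtain ⟨G, hG0, hG⟩ := exists_gradient_bound hLf
  -- `H` bounds all admissible directions
  set H : ℝ := (Lg + G) * (4 * μ / 3) with hH
  have hH0 : 0 ≤ H := by positivity
  refine ⟨min 1 (min (δ / (2 * (H + 1))) (5 / (8 * μ) / (C + 1))), by positivity,
    fun B x hx η hη α hα hαle => ?_⟩
  obtain ⟨hηT, p, ζ, -, -, -, hdec⟩ := hη.exists_subgradient hlam hμ hLg
  have hα1 : α ≤ 1 := hαle.trans (min_le_left _ _)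
  have hα2 : α * (2 * (H + 1)) ≤ δ :=
    (le_div_iff₀ (by positivity)).1 (hαle.trans ((min_le_right _ _).trans (min_le_left _ _)))
  have hα3 : α * (C + 1) ≤ 5 / (8 * μ) :=
    (le_div_iff₀ (by positivity)).1 (hαle.trans ((min_le_right _ _).trans (min_le_right _ _)))
  have hηH : ‖η‖ ≤ H := by
    have a1 : regularizer lam x - regularizer lam (x + η) ≤ Lg * ‖η‖ := by
      have := (le_abs_self _).trans (hLg.norm_sub_le x (x + η))
      rwa [sub_add_cancel_left, norm_neg] at this
    have a2 : -inner ℝ (gradient f x) η ≤ G * ‖η‖ :=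
      (neg_le_abs _).trans ((abs_real_inner_le_norm _ _).trans
        (mul_le_mul_of_nonneg_right (hG x hx) (norm_nonneg _)))
    have a3 : ‖η‖ ^ 2 ≤ H * ‖η‖ := by
      have a4 : 3 / (4 * μ) * ‖η‖ ^ 2 ≤ (Lg + G) * ‖η‖ := by linarith
      have a5 := mul_le_mul_of_nonneg_left a4 (show 0 ≤ 4 * μ / 3 by positivity)
      have a6 : 4 * μ / 3 * (3 / (4 * μ) * ‖η‖ ^ 2) = ‖η‖ ^ 2 := by field_simp
      rw [hH]; linarith
    by_contra! hc
    nlinarith [norm_nonneg η]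
  have hnorm : ‖α • η‖ = α * ‖η‖ := by rw [norm_smul, Real.norm_eq_abs, abs_of_pos hα]
  have h1 := h x hx (α • η) ((tangentSpace v x).smul_mem α hηT) (by rw [hnorm]; nlinarith)
  have h2 := (convexOn_regularizer (n := n) (q := q) hlam).2 (mem_univ x) (mem_univ (x + η))
    (sub_nonneg.2 hα1) hα.le (by ring)
  have e : (1 - α) • x + α • (x + η) = x + α • η := by
    rw [sub_smul, one_smul, smul_add]; abel
  rw [e, smul_eq_mul, smul_eq_mul] at h2
  rw [hnorm, inner_smul_right] at h1
  have h3 := mul_le_mul_of_nonneg_left hdec hα.le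
  have h4 : C * (α * ‖η‖) ^ 2 ≤ 5 / (8 * μ) * (α * ‖η‖ ^ 2) := by
    have : C * (α * ‖η‖) ^ 2 = (α * C) * (α * ‖η‖ ^ 2) := by ring
    rw [this]
    exact mul_le_mul_of_nonneg_right (by linarith) (by positivity)
  have h5 : σ * (α * ‖η‖ ^ 2) ≤ 1 / (8 * μ) * (α * ‖η‖ ^ 2) :=
    mul_le_mul_of_nonneg_right hσ (by positivity)
  have h6 : 3 / (4 * μ) = 5 / (8 * μ) + 1 / (8 * μ) := by field_simp; norm_num
  rw [h6] at h3
  simp only [objective] at h1 ⊢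
  linarith

/-! ### Limits of admissible directions -/

/-- If admissible directions at `z i` tend to zero while `z i` tends to `zstar`, then `zstar` is
stationary: the bounded subgradients of `g` converge along the ultrafilter, and tangent vectors at
`zstar` are limits of tangent vectors at `z i`. -/
theorem isStationaryPoint_of_tendsto {n q : ℕ} {v : Fin n → ℝ} {f : MatSpace n q → ℝ}
    (hf : ∀ x ∈ feasible q v, DifferentiableAt ℝ f x) {Lf : NNReal}
    (hLf : LipschitzOnWith Lf (gradient f) (feasible q v)) {lam μ : ℝ} (hlam : 0 ≤ lam)
    {Lg : NNReal} (hLg : LipschitzWith Lg (regularizer lam : MatSpace n q → ℝ)) (hμ : 0 < μ)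
    {B : NormalFrame q v} {ι : Type*} (U : Ultrafilter ι) {z η : ι → MatSpace n q}
    {zstar : MatSpace n q} (hz : ∀ i, z i ∈ feasible q v)
    (hη : ∀ i, IsInexactDirection v f lam Lg μ B (z i) (η i))
    (hη0 : Tendsto η U (𝓝 0)) (hzs : Tendsto z U (𝓝 zstar)) :
    IsStationaryPoint v f lam zstar := by
  have hzM : zstar ∈ feasible q v :=
    (isCompact_feasible v).isClosed.mem_of_tendsto hzs (Eventually.of_forall hz)
  choose hηT p ζ hsub htan hnear _ using fun i => (hη i).exists_subgradient hlam hμ hLg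
  obtain ⟨ζs, -, hζs⟩ := (isCompact_closedBall (0 : MatSpace n q) Lg).ultrafilter_le_nhds
    (U.map ζ) (by
      rw [le_principal_iff, Ultrafilter.coe_map, mem_map]
      exact Eventually.of_forall fun i => mem_closedBall_zero_iff.2
        (norm_le_of_forall_inner_le hLg (hsub i)))
  have hζ : Tendsto ζ U (𝓝 ζs) := hζs
  have hp : Tendsto p U (𝓝 zstar) := by
    have h1 : Tendsto (fun i => p i - z i - η i) U (𝓝 0) :=
      squeeze_zero_norm hnear (by simpa using hη0.norm)
    have h2 := (h1.add hη0).add hzs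
    simpa using h2
  have hcont := hLg.continuous
  have hsub' : ∀ w, inner ℝ ζs (w - zstar) ≤ regularizer lam w - regularizer lam zstar :=
    fun w => le_of_tendsto_of_tendsto' (hζ.inner (tendsto_const_nhds.sub hp))
      (tendsto_const_nhds.sub ((hcont.tendsto _).comp hp)) fun i => hsub i w
  have hgrad : Tendsto (fun i => gradient f (z i)) U (𝓝 (gradient f zstar)) :=
    (hLf.continuousOn zstar hzM).tendsto.comp
      (tendsto_nhdsWithin_iff.2 ⟨hzs, Eventually.of_forall hz⟩)
  have horth : ∀ τ ∈ tangentSpace v zstar, inner ℝ (ζs + gradient f zstar) τ = 0 := by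
    intro τ hτ
    obtain ⟨W, hW, hWz, hWT⟩ := exists_continuous_tangent_field hzM hτ
    have hWt : Tendsto (fun i => W (z i)) U (𝓝 τ) := hWz ▸ (hW.tendsto zstar).comp hzs
    have h1 := (hζ.add hgrad).inner (𝕜 := ℝ) hWt
    have h2 := ((hη0.inner (𝕜 := ℝ) hWt).const_mul μ⁻¹).neg
    rw [inner_zero_left, mul_zero, neg_zero] at h2
    exact tendsto_nhds_unique (h1.congr fun i => htan i _ (hWT _ (hz i))) h2
  refine ⟨hzM, ζs + gradient f zstar, ?_, ?_⟩
  · refine (mem_subdifferential_add_iff (hf _ hzM) (convexOn_regularizer hlam) _).2 fun y => ?_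
    rw [add_sub_cancel_right]
    linarith [hsub' y]
  · rw [Submodule.starProjection_apply_eq_zero_iff, Submodule.mem_orthogonal]
    intro τ hτ
    rw [real_inner_comm]
    exact horth τ hτ

/-! ### Runs of the algorithm -/

/-- Each decrease of a sequence that is bounded below tends to zero. -/
theorem tendsto_zero_of_le_sub {a b : ℕ → ℝ} {c m : ℝ} (hc : 0 < c) (hb : ∀ j, 0 ≤ b j)
    (ha : ∀ j, m ≤ a j) (h : ∀ j, a (j + 1) ≤ a j - c * b j) : Tendsto b atTop (𝓝 0) := by
  have hanti : Antitone a := antitone_nat_of_succ_le fun j =>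
    (h j).trans (sub_le_self _ (mul_nonneg hc.le (hb j)))
  have hlim := tendsto_atTop_ciInf hanti ⟨m, by rintro _ ⟨j, rfl⟩; exact ha j⟩
  have h1 := (hlim.sub ((tendsto_add_atTop_iff_nat 1).2 hlim)).div_const c
  rw [sub_self, zero_div] at h1
  refine squeeze_zero hb (fun j => ?_) h1
  rw [le_div_iff₀ hc]
  linarith [h j]

theorem AManPGRun.z_mem_feasible {n q : ℕ} {v : Fin n → ℝ} {f : MatSpace n q → ℝ} {lam Lg : ℝ}
    {D : Set (MatSpace n q × MatSpace n q)} {R : MatSpace n q × MatSpace n q → MatSpace n q}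
    (hR : IsRetraction v D R) {B : NormalFrame q v} {μ σ ν : ℝ} {N Nmax : ℕ}
    (r : AManPGRun v f lam Lg D R B μ σ ν N Nmax) :
    ∀ j, r.z (j * N) ∈ feasible q v := by
  have hx : ∀ k, r.x k ∈ feasible q v := by
    rintro (_ | k)
    · exact r.x_zero_mem
    · rw [r.x_next]
      exact hR.mapsTo _ (r.etaY_mem k)
  rintro (_ | j)
  · rw [zero_mul, r.z_zero]
    exact hx 0
  · have hk : (j * N) % N = 0 := Nat.mul_mod_left _ _
    rw [Nat.succ_mul, r.z_next _ hk]
    by_cases hF : objective f lam (R (r.z (j * N), ν ^ r.iter (j * N) • r.etaZ (j * N))) <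
        objective f lam (r.x (j * N))
    · rw [(r.safeguard_effect _ hk hF).1]
      exact hR.mapsTo _ (r.search_mem _ hk _ le_rfl)
    · rw [(r.safeguard_keep _ hk hF).1]
      exact hx _

theorem mainTheorem7 {n q : ℕ} (v : Fin n → ℝ) (hv : ∀ i, 0 < v i)
    (f : MatSpace n q → ℝ) (hf : ∀ x ∈ feasible q v, DifferentiableAt ℝ f x)
    (Lf : NNReal) (hLf : LipschitzOnWith Lf (gradient f) (feasible q v))
    (lam : ℝ) (hlam : 0 ≤ lam)
    (Lg : NNReal) (hLg : LipschitzWith Lg (regularizer lam : MatSpace n q → ℝ))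
    (D : Set (MatSpace n q × MatSpace n q)) (R : MatSpace n q × MatSpace n q → MatSpace n q)
    (hR : IsRetraction v D R)
    (μ σ ν : ℝ) (hμ : 0 < μ) (hσ : σ ∈ Set.Ioc 0 (1 / (8 * μ))) (hν : ν ∈ Set.Ioo 0 1) :
    ∃ Nbar : ℕ, ∀ (B : NormalFrame q v) (N : ℕ), 0 < N → ∀ (Nmax : ℕ)
      (r : AManPGRun v f lam Lg D R B μ σ ν N Nmax),
      (Nbar ≤ Nmax → r.LineSearchNeverFails) ∧
      (r.LineSearchNeverFails →
        ∀ zstar : MatSpace n q, MapClusterPt zstar Filter.atTop (fun i : ℕ => r.z (i * N)) →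
          IsStationaryPoint v f lam zstar) := by
  obtain ⟨α₀, hα₀, hdec⟩ := hR.exists_sufficient_decrease hf hLf hlam hLg hμ hσ.2
  obtain ⟨m, hm⟩ := exists_pow_lt_of_lt_one hα₀ hν.2
  refine ⟨m + 1, fun B N hN Nmax run => ?_⟩
  have hzM := run.z_mem_feasible hR
  -- the counter never exceeds `m`, since the step size `ν ^ m` is accepted
  have hiter : ∀ j, run.iter (j * N) ≤ m := by
    intro j
    have hk : (j * N) % N = 0 := Nat.mul_mod_left _ _
    by_contra! hlt
    exact absurd (run.search_continue _ hk m hlt).1 (not_lt.2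
      (hdec B _ (hzM j) _ (run.etaZ_inexact _ hk) _ (pow_pos hν.1 m) hm.le))
  refine ⟨fun hmax k hk => ?_, fun hnf zstar hz => ?_⟩
  · have := hiter (k / N)
    rw [Nat.div_mul_cancel (Nat.dvd_of_mod_eq_zero hk)] at this
    omega
  · have hstep : ∀ j, objective f lam (run.z ((j + 1) * N)) ≤
        objective f lam (run.z (j * N)) - σ * ν ^ m * ‖run.etaZ (j * N)‖ ^ 2 := by
      intro j
      have hk : (j * N) % N = 0 := Nat.mul_mod_left _ _
      -- a counter above `N_max` is impossible, so it is below `N_max` if the search did not fail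
      have hlt : run.iter (j * N) < Nmax := by
        refine lt_of_le_of_ne ?_ (hnf _ hk)
        by_contra! hgt
        exact lt_irrefl _ (run.search_continue _ hk Nmax hgt).2
      have h1 : objective f lam (R (run.z (j * N), ν ^ run.iter (j * N) • run.etaZ (j * N))) ≤
          objective f lam (run.z (j * N)) - σ * ν ^ run.iter (j * N) * ‖run.etaZ (j * N)‖ ^ 2 :=
        not_lt.1 fun hc => run.search_stop _ hk ⟨hc, hlt⟩
      have h2 : σ * ν ^ m * ‖run.etaZ (j * N)‖ ^ 2 ≤
          σ * ν ^ run.iter (j * N) * ‖run.etaZ (j * N)‖ ^ 2 :=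
        mul_le_mul_of_nonneg_right (mul_le_mul_of_nonneg_left
          (pow_le_pow_of_le_one hν.1.le hν.2.le (hiter j)) hσ.1.le) (sq_nonneg _)
      rw [Nat.succ_mul, run.z_next _ hk]
      by_cases hF : objective f lam (R (run.z (j * N), ν ^ run.iter (j * N) • run.etaZ (j * N))) <
          objective f lam (run.x (j * N))
      · rw [(run.safeguard_effect _ hk hF).1]
        linarith
      · rw [(run.safeguard_keep _ hk hF).1]
        linarith [not_lt.1 hF]
    have hFc : ContinuousOn (objective f lam) (feasible q v) := fun x hx =>
      ((hf x hx).continuousAt.add hLg.continuous.continuousAt).continuousWithinAt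
    obtain ⟨c, hc⟩ := (isCompact_feasible v).bddBelow_image hFc
    have h0 := tendsto_zero_of_le_sub (mul_pos hσ.1 (pow_pos hν.1 m)) (fun j => sq_nonneg _)
      (fun j => hc ⟨_, hzM j, rfl⟩) hstep
    have hη : Tendsto (fun j => run.etaZ (j * N)) atTop (𝓝 0) := by
      rw [tendsto_zero_iff_norm_tendsto_zero]
      simpa [Real.sqrt_sq] using h0.sqrt
    obtain ⟨U, hU, hzU⟩ := mapClusterPt_iff_ultrafilter.1 hz
    exact isStationaryPoint_of_tendsto hf hLf hlam hLg hμ U hzM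
      (fun j => run.etaZ_inexact _ (Nat.mul_mod_left _ _)) (hη.mono_left hU) hzU
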